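/- A \emph{majorant} is a continuous increasing function $\psi:[0,\infty)\to[0,\infty)$ with $\psi(0)=0$ such that $\psi(t)/t$ is non-increasing for $t>0$. It is \emph{fast} if there are constants $\delta_0>0$ and $C>0$ with $\int_0^{\delta}\frac{\psi(t)}{t}\,dt\le C\psi(\delta)$ for all $0<\delta<\delta_0$. Let $n\ge 1$, let $\psi$ be a fast majorant, and let $\Omega_1\subset\mathbb{C}^n$ be a bounded domain. Write $d_{\Omega_1}(z)$ for the Euclidean distance from $z$ to $\partial\Omega_1$. For $z_1,z_2\in\Omega_1$ put $$d_{\psi,\Omega_1}(z_1,z_2)=\inf_{\gamma}\int_\gamma\frac{\psi(d_{\Omega_1}(z))}{d_{\Omega_1}(z)}\,ds(z),$$ where the infimum is over all rectifiable curves $\gamma\subset\Omega_1$ joining $z_1$ to $z_2$ and $ds$ is arc length. For a real- or complex-valued function $F$ on $\Omega_1$ write $F\in\mathscr{L}_{\psi,\mathrm{int}}(\Omega_1)$ if there is a constant $C>0$ with $|F(z_1)-F(z_2)|\le C\,d_{\psi,\Omega_1}(z_1,z_2)$ for all $z_1,z_2\in\Omega_1$. For a real-valued differentiable function $u$ of $z=(x_1+iy_1,\dots,x_n+iy_n)\in\Omega_1$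 let $\nabla u=(u_{x_1},u_{y_1},\dots,u_{x_n},u_{y_n})$, let $|\nabla u|$ be its Euclidean norm, and for $p>0$ let $$I_{u,p}(z)=\Big(\frac{1}{|B_z|}\int_{B_z}|\nabla u(w)|^p\,d\mu(w)\Big)^{1/p},\qquad B_z=\{w\in\mathbb{C}^n:|w-z|<d_{\Omega_1}(z)/2\},$$ where $\mu$ is Lebesgue measure on $\mathbb{C}^n$ and $|B_z|=\mu(B_z)$. Let $u,v$ be real-valued functions on $\Omega_1$ such that $f=u+iv$ is holomorphic on $\Omega_1$ (so that $u$ and $v$ are pluriharmonic). Let $p,q>0$ be given; if $n\ge2$, assume moreover that $p\ge\frac{2n-2}{2n-1}$ and $q\ge\frac{2n-2}{2n-1}$. Then the following ten statements are equivalent: \begin{enumerate} \item $u\in\mathscr{L}_{\psi,\mathrm{int}}(\Omega_1)$; \item there is a constant $C>0$ such that $|\nabla u(z)|\le C\,\frac{\psi(d_{\Omega_1}(z))}{d_{\Omega_1}(z)}$ for all $z\in\Omega_1$; \item $|u|\in\mathscr{L}_{\psi,\mathrm{int}}(\Omega_1)$; \item there is a constant $C>0$ such that $I_{u,p}(z)\le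 C\,\frac{\psi(d_{\Omega_1}(z))}{d_{\Omega_1}(z)}$ for all $z\in\Omega_1$; \item $v\in\mathscr{L}_{\psi,\mathrm{int}}(\Omega_1)$; \item there is a constant $C>0$ such that $|\nabla v(z)|\le C\,\frac{\psi(d_{\Omega_1}(z))}{d_{\Omega_1}(z)}$ for all $z\in\Omega_1$; \item $|v|\in\mathscr{L}_{\psi,\mathrm{int}}(\Omega_1)$; \item there is a constant $C>0$ such that $I_{v,q}(z)\le C\,\frac{\psi(d_{\Omega_1}(z))}{d_{\Omega_1}(z)}$ for all $z\in\Omega_1$; \item $f\in\mathscr{L}_{\psi,\mathrm{int}}(\Omega_1)$; \item $|f|\in\mathscr{L}_{\psi,\mathrm{int}}(\Omega_1)$. \end{enumerate} -/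

import Mathlib

open Set MeasureTheory
open scoped ENNReal

noncomputable section

/-- A majorant: a continuous increasing function `ψ : [0,∞) → [0,∞)` with `ψ 0 = 0` such that
`ψ t / t` is non-increasing on `(0,∞)`. (Only the values on `[0,∞)` matter; non-negativity there
follows from monotonicity and `ψ 0 = 0`.) -/
structure IsMajorant (ψ : ℝ → ℝ) : Prop where
  continuousOn : ContinuousOn ψ (Ici 0)
  monotoneOn : MonotoneOn ψ (Ici 0)
  map_zero : ψ 0 = 0
  antitoneOn_div : AntitoneOn (fun t => ψ t / t) (Ioi 0)

/-- A fast majorant: there are `δ₀ > 0` and `C > 0` with `∫₀^δ ψ(t)/t dt ≤ C ψ(δ)` for all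
`0 < δ < δ₀`. The integral is the `[0,∞]`-valued one, so the inequality includes convergence. -/
structure IsFastMajorant (ψ : ℝ → ℝ) : Prop extends IsMajorant ψ where
  fast : ∃ δ₀ : ℝ, 0 < δ₀ ∧ ∃ C : ℝ, 0 < C ∧ ∀ δ : ℝ, 0 < δ → δ < δ₀ →
    ∫⁻ t in Ioo 0 δ, ENNReal.ofReal (ψ t / t) ≤ ENNReal.ofReal (C * ψ δ)

/-- `d_Ω(z)`, the Euclidean distance from `z` to the boundary of `Ω`. -/
def bdryDist {n : ℕ} (Ω : Set (EuclideanSpace ℂ (Fin n))) (z : EuclideanSpace ℂ (Fin n)) : ℝ :=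
  Metric.infDist z (frontier Ω)

/-- `γ`, restricted to `[0,1]`, is a rectifiable curve in `Ω` joining `z` to `w`. -/
structure IsRectifiableCurve {n : ℕ} (Ω : Set (EuclideanSpace ℂ (Fin n)))
    (z w : EuclideanSpace ℂ (Fin n)) (γ : ℝ → EuclideanSpace ℂ (Fin n)) : Prop where
  continuousOn : ContinuousOn γ (Icc 0 1)
  rectifiable : eVariationOn γ (Icc 0 1) ≠ ∞
  mapsTo : MapsTo γ (Icc 0 1) Ω
  source : γ 0 = z
  target : γ 1 = w

/-- The arc length integral `∫_γ g ds` of a non-negative function along the curve `γ` on `[0,1]`: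
the integral of `g` along the parametrization of `γ` by arc length, over `[0, length γ]`. -/
def arcLengthIntegral {n : ℕ} (γ : ℝ → EuclideanSpace ℂ (Fin n))
    (g : EuclideanSpace ℂ (Fin n) → ℝ) : ℝ≥0∞ :=
  ∫⁻ s in Icc 0 (eVariationOn γ (Icc 0 1)).toReal,
    ENNReal.ofReal (g (naturalParameterization γ (Icc 0 1) 0 s))

/-- The internal distance `d_{ψ,Ω}(z,w)`: the infimum of `∫_γ ψ(d_Ω)/d_Ω ds` over all rectifiable
curves `γ` in `Ω` joining `z` to `w`. -/
def internalDist {n : ℕ} (ψ : ℝ → ℝ) (Ω : Set (EuclideanSpace ℂ (Fin n)))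
    (z w : EuclideanSpace ℂ (Fin n)) : ℝ≥0∞ :=
  ⨅ (γ : ℝ → EuclideanSpace ℂ (Fin n)) (_ : IsRectifiableCurve Ω z w γ),
    arcLengthIntegral γ (fun ζ => ψ (bdryDist Ω ζ) / bdryDist Ω ζ)

/-- `F` is Lipschitz on `Ω` with respect to the internal distance `d_{ψ,Ω}`. -/
def InternalLipschitz {n : ℕ} {G : Type*} [NormedAddCommGroup G] (ψ : ℝ → ℝ)
    (Ω : Set (EuclideanSpace ℂ (Fin n))) (F : EuclideanSpace ℂ (Fin n) → G) : Prop :=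
  ∃ C : ℝ, 0 < C ∧ ∀ z₁ ∈ Ω, ∀ z₂ ∈ Ω,
    ENNReal.ofReal ‖F z₁ - F z₂‖ ≤ ENNReal.ofReal C * internalDist ψ Ω z₁ z₂

/-- `|∇u(z)|`, the Euclidean norm of `(u_{x₁}, u_{y₁}, …, u_{xₙ}, u_{yₙ})` at `z`, where
`z_j = x_j + i y_j`. -/
def gradNorm {n : ℕ} (u : EuclideanSpace ℂ (Fin n) → ℝ) (z : EuclideanSpace ℂ (Fin n)) : ℝ :=
  Real.sqrt (∑ j : Fin n,
    ((lineDeriv ℝ u z (EuclideanSpace.single j (1 : ℂ))) ^ 2 +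
      (lineDeriv ℝ u z (EuclideanSpace.single j Complex.I)) ^ 2))

/-- `I_{u,p}(z) = |B|^{-1/p} (∫_B |∇u|^p dμ)^{1/p}` with `B = B(z, d_Ω(z)/2)` and `μ` the Lebesgue
measure on `ℂⁿ = ℝ²ⁿ`. -/
def gradAverage {n : ℕ} (Ω : Set (EuclideanSpace ℂ (Fin n))) (u : EuclideanSpace ℂ (Fin n) → ℝ)
    (p : ℝ) (z : EuclideanSpace ℂ (Fin n)) : ℝ≥0∞ :=
  (volume (Metric.ball z (bdryDist Ω z / 2))) ^ (-1 / p) *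
    (∫⁻ w in Metric.ball z (bdryDist Ω z / 2), ENNReal.ofReal (gradNorm u w ^ p)) ^ (1 / p)

/-- `|∇u| ≤ C ψ(d_Ω)/d_Ω` on `Ω` for some constant `C > 0`. -/
def GradBound {n : ℕ} (ψ : ℝ → ℝ) (Ω : Set (EuclideanSpace ℂ (Fin n)))
    (u : EuclideanSpace ℂ (Fin n) → ℝ) : Prop :=
  ∃ C : ℝ, 0 < C ∧ ∀ z ∈ Ω, gradNorm u z ≤ C * (ψ (bdryDist Ω z) / bdryDist Ω z)

/-- `I_{u,p} ≤ C ψ(d_Ω)/d_Ω` on `Ω` for some constant `C > 0`. -/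
def GradAverageBound {n : ℕ} (ψ : ℝ → ℝ) (Ω : Set (EuclideanSpace ℂ (Fin n)))
    (u : EuclideanSpace ℂ (Fin n) → ℝ) (p : ℝ) : Prop :=
  ∃ C : ℝ, 0 < C ∧ ∀ z ∈ Ω,
    gradAverage Ω u p z ≤ ENNReal.ofReal (C * (ψ (bdryDist Ω z) / bdryDist Ω z))

end

/-! Everything is equivalent to one growth bound, `‖Df(z)‖ ≤ C ψ(d(z))/d(z)`. Both `u` and `v` are
real parts of unimodular multiples of `f`, so by Cauchy–Riemann `|∇u| = ‖Df‖ = |∇v|`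
(`gradNorm_eq_norm_fderiv`); the pointwise gradient conditions are that bound itself.

Integrating the bound along curves parametrized by arc length makes `f` internally Lipschitz
(`internalLipschitz_of_norm_fderiv_le`), hence also `u`, `v` and the absolute values. Conversely,
testing with the segment from `w` to `z` gives internal distance at most `2 (ψ(d)/d) |w - z|` for
`w` near `z`, so an internally Lipschitz `F` has controlled local slope. If the increments of `F`
dominate `Re (b (f w - f z))` for some unimodular `b`, rotating the complex direction turns this
into a bound for the whole of `‖Df(z)‖` (`norm_fderiv_le_of_re_le`). Such a `b` exists for `|u|` and
`|v|`, since signs are locally constant off the zero set, and for `|f|`, by rotating `f z` onto the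
nonnegative axis.

For the averages, `ψ(d)/d` grows by at most a factor 2 on the half-radius ball, so the pointwise
bound implies the averaged one. For the converse, `‖Df(·) e‖ ^ p` has the sub-mean value property
for every `p > 0`: Jensen's formula handles `log |g|`, convexity of `exp` passes to `|g| ^ p`, and
rotation invariance passes from circles to balls. -/

section Auxiliary

open Filter Topology

/-! ### Arc length parametrizations -/

section ArcLength

variable {E : Type*} [PseudoEMetricSpace E] {γ : ℝ → E} {a b : ℝ}

/-- The variation of a continuous function of bounded variation is continuous. -/
theorem ContinuousOn.variationOnFromTo {s : Set ℝ} (hc : ContinuousOn γ s)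
    (hv : BoundedVariationOn γ s) (ha : a ∈ s) : ContinuousOn (variationOnFromTo γ s a) s := by
  intro x hx
  -- Whichever side of `x` the point `y` lies on, one of the two subtracted variations vanishes, so
  -- a single formula covers both one-sided limits.
  have hadd : ∀ y ∈ s, _root_.variationOnFromTo γ s a y =
      _root_.variationOnFromTo γ s a x + ((eVariationOn γ (s ∩ Icc x y)).toReal -
        (eVariationOn γ (s ∩ Icc y x)).toReal) := by
    intro y hy
    rw [← variationOnFromTo.add hv.locallyBoundedVariationOn ha hx hy]
    congr 1
    rcases lt_trichotomy x y with h | rfl | h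
    · rw [variationOnFromTo.eq_of_le _ _ h.le, eVariationOn.subsingleton γ (s := s ∩ Icc y x)]
      · simp
      · simp [Icc_eq_empty_of_lt h]
    · simp [variationOnFromTo.self]
    · rw [variationOnFromTo.eq_of_ge _ _ h.le, eVariationOn.subsingleton γ (s := s ∩ Icc x y)]
      · simp
      · simp [Icc_eq_empty_of_lt h]
  refine ContinuousWithinAt.congr (f := fun y => _root_.variationOnFromTo γ s a x +
    ((eVariationOn γ (s ∩ Icc x y)).toReal - (eVariationOn γ (s ∩ Icc y x)).toReal)) ?_ hadd
      (hadd x hx)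
  have hr := hv.tendsto_eVariationOn_Icc_zero_right x ((hc x hx).mono inter_subset_left)
  have hl := hv.tendsto_eVariationOn_Icc_zero_left ((hc x hx).mono inter_subset_left)
  have ht := ((ENNReal.tendsto_toReal ENNReal.zero_ne_top).comp hr).sub
    ((ENNReal.tendsto_toReal ENNReal.zero_ne_top).comp hl)
  refine continuousWithinAt_const.add ?_
  have h0 : eVariationOn γ (s ∩ Icc x x) = 0 :=
    eVariationOn.subsingleton γ (by simpa using subsingleton_singleton.anti inter_subset_right)
  simpa [ContinuousWithinAt, Function.comp_def, h0] using ht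

/-- `naturalParameterization` inverts the variation function and is controlled only on its range.
Continuity and the intermediate value theorem show that this range has no gaps. -/
theorem variationOnFromTo_image_Icc (hab : a ≤ b) (hc : ContinuousOn γ (Icc a b))
    (hv : BoundedVariationOn γ (Icc a b)) :
    variationOnFromTo γ (Icc a b) a '' Icc a b = Icc 0 (eVariationOn γ (Icc a b)).toReal := by
  have ha : a ∈ Icc a b := left_mem_Icc.2 hab
  have hb : variationOnFromTo γ (Icc a b) a b = (eVariationOn γ (Icc a b)).toReal := by
    rw [variationOnFromTo.eq_of_le _ _ hab, inter_self]
  have hmono := variationOnFromTo.monotoneOn hv.locallyBoundedVariationOn ha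
  rw [← hb, ← variationOnFromTo.self γ (Icc a b) a]
  refine Subset.antisymm ?_ (intermediate_value_Icc hab (hc.variationOnFromTo hv ha))
  rintro _ ⟨t, ht, rfl⟩
  exact ⟨hmono ha ht ht.1, hmono ht (right_mem_Icc.2 hab) ht.2⟩

theorem mapsTo_naturalParameterization (hab : a ≤ b) (hc : ContinuousOn γ (Icc a b))
    (hv : BoundedVariationOn γ (Icc a b)) :
    MapsTo (naturalParameterization γ (Icc a b) a) (Icc 0 (eVariationOn γ (Icc a b)).toReal)
      (γ '' Icc a b) := by
  intro t ht
  rw [← variationOnFromTo_image_Icc hab hc hv] at ht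
  exact mem_image_of_mem γ (Function.invFunOn_mem ht)

end ArcLength

section ArcLengthMetric

variable {E : Type*} [MetricSpace E] {γ : ℝ → E} {a b : ℝ}

theorem naturalParameterization_zero (hab : a ≤ b) (hv : BoundedVariationOn γ (Icc a b)) :
    naturalParameterization γ (Icc a b) a 0 = γ a := by
  have ha : a ∈ Icc a b := left_mem_Icc.2 hab
  have := edist_naturalParameterization_eq_zero hv.locallyBoundedVariationOn ha ha
  rwa [variationOnFromTo.self, edist_eq_zero] at this

theorem naturalParameterization_length (hab : a ≤ b) (hv : BoundedVariationOn γ (Icc a b)) :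
    naturalParameterization γ (Icc a b) a (eVariationOn γ (Icc a b)).toReal = γ b := by
  have := edist_naturalParameterization_eq_zero hv.locallyBoundedVariationOn
    (left_mem_Icc.2 hab) (right_mem_Icc.2 hab)
  rwa [variationOnFromTo.eq_of_le _ _ hab, inter_self, edist_eq_zero] at this

/-- Unit speed makes the variation between two parameters equal to their difference, and a chord is
no longer than the variation. -/
theorem lipschitzOnWith_naturalParameterization (hab : a ≤ b) (hc : ContinuousOn γ (Icc a b))
    (hv : BoundedVariationOn γ (Icc a b)) :
    LipschitzOnWith 1 (naturalParameterization γ (Icc a b) a)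
      (Icc 0 (eVariationOn γ (Icc a b)).toReal) := by
  have hs := has_unit_speed_naturalParameterization γ hv.locallyBoundedVariationOn
    (left_mem_Icc.2 hab)
  rw [variationOnFromTo_image_Icc hab hc hv] at hs
  refine LipschitzOnWith.of_dist_le_mul ?_
  have key : ∀ x ∈ Icc 0 (eVariationOn γ (Icc a b)).toReal,
      ∀ y ∈ Icc 0 (eVariationOn γ (Icc a b)).toReal, x ≤ y →
      dist (naturalParameterization γ (Icc a b) a x) (naturalParameterization γ (Icc a b) a y)
        ≤ dist x y := by
    intro x hx y hy hxy
    have h := eVariationOn.edist_le (naturalParameterization γ (Icc a b) a)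
      (s := Icc 0 (eVariationOn γ (Icc a b)).toReal ∩ Icc x y)
      ⟨hx, left_mem_Icc.2 hxy⟩ ⟨hy, right_mem_Icc.2 hxy⟩
    rw [hs hx hy, edist_dist, ENNReal.ofReal_le_ofReal_iff (by simpa using hxy)] at h
    rw [dist_comm x y, Real.dist_eq, abs_of_nonneg (sub_nonneg.2 hxy)]
    simpa using h
  intro x hx y hy
  rw [NNReal.coe_one, one_mul]
  rcases le_total x y with h | h
  · exact key x hx y hy h
  · rw [dist_comm, dist_comm x y]
    exact key y hy x hx h

end ArcLengthMetric

/-! ### Majorants and the distance to the boundary -/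

section BoundaryDistance

variable {n : ℕ} {ψ : ℝ → ℝ} {Ω : Set (EuclideanSpace ℂ (Fin n))}
  {z w : EuclideanSpace ℂ (Fin n)}

theorem IsMajorant.nonneg (hψ : IsMajorant ψ) {t : ℝ} (ht : 0 ≤ t) : 0 ≤ ψ t := by
  rw [← hψ.map_zero]
  exact hψ.monotoneOn self_mem_Ici ht ht

/-- Pass from `s` down to `t / 2` by monotonicity of the quotient, then from `ψ (t / 2)` up to `ψ
t`; the factor 2 is the denominator `t / 2`. -/
theorem IsMajorant.div_le_two_mul (hψ : IsMajorant ψ) {s t : ℝ} (ht : 0 < t) (hs : t / 2 ≤ s) :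
    ψ s / s ≤ 2 * (ψ t / t) := by
  have ht2 : 0 < t / 2 := half_pos ht
  calc ψ s / s ≤ ψ (t / 2) / (t / 2) := hψ.antitoneOn_div ht2 (ht2.trans_le hs) hs
    _ ≤ ψ t / (t / 2) := by
        gcongr
        exact hψ.monotoneOn ht2.le ht.le (by linarith)
    _ = 2 * (ψ t / t) := by field_simp

theorem frontier_nonempty_of_isBounded (hn : 1 ≤ n) (hΩb : Bornology.IsBounded Ω)
    (hne : Ω.Nonempty) : (frontier Ω).Nonempty := by
  have : NeZero n := ⟨by omega⟩
  rw [nonempty_frontier_iff]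
  refine ⟨hne, ?_⟩
  rintro rfl
  exact NormedSpace.unbounded_univ ℂ (EuclideanSpace ℂ (Fin n)) hΩb

theorem bdryDist_pos (hΩo : IsOpen Ω) (hfr : (frontier Ω).Nonempty) (hz : z ∈ Ω) :
    0 < bdryDist Ω z := by
  refine (isClosed_frontier.notMem_iff_infDist_pos hfr).1 fun h => ?_
  rw [hΩo.frontier_eq] at h
  exact h.2 hz

theorem half_bdryDist_le (hw : w ∈ Metric.ball z (bdryDist Ω z / 2)) :
    bdryDist Ω z / 2 ≤ bdryDist Ω w := by
  have h : bdryDist Ω z ≤ bdryDist Ω w + dist z w := Metric.infDist_le_infDist_add_dist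
  rw [Metric.mem_ball, dist_comm] at hw
  linarith

/-- The ball is connected, meets `Ω` and misses the frontier, so `Ω` and the complement of its
closure cannot separate it. -/
theorem ball_bdryDist_subset (hΩo : IsOpen Ω) (hz : z ∈ Ω) :
    Metric.ball z (bdryDist Ω z) ⊆ Ω := by
  rcases le_or_gt (bdryDist Ω z) 0 with hd | hd
  · simp [Metric.ball_eq_empty.2 hd]
  refine (convex_ball z (bdryDist Ω z)).isPreconnected.subset_left_of_subset_union hΩo
    isClosed_closure.isOpen_compl (disjoint_compl_right.mono_left subset_closure) ?_
    ⟨z, Metric.mem_ball_self hd, hz⟩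
  intro y hy
  by_contra h
  simp only [mem_union, mem_compl_iff, not_or, not_not] at h
  have hyf : y ∈ frontier Ω := by
    rw [hΩo.frontier_eq]
    exact ⟨h.2, h.1⟩
  rw [Metric.mem_ball, dist_comm] at hy
  exact absurd hy (not_lt.2 (Metric.infDist_le_dist_of_mem hyf))

theorem IsMajorant.continuousOn_div_bdryDist (hψ : IsMajorant ψ) (hΩo : IsOpen Ω)
    (hfr : (frontier Ω).Nonempty) :
    ContinuousOn (fun ζ => ψ (bdryDist Ω ζ) / bdryDist Ω ζ) Ω := by
  have hd : Continuous (bdryDist Ω) := Metric.continuous_infDist_pt _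
  refine ContinuousOn.div ?_ hd.continuousOn fun ζ hζ => (bdryDist_pos hΩo hfr hζ).ne'
  exact hψ.continuousOn.comp hd.continuousOn fun ζ _ => Metric.infDist_nonneg

end BoundaryDistance

/-! ### Derivative bounds and internal Lipschitz conditions -/

/-- A function composed with a `1`-Lipschitz curve varies by at most the integral of a bound of its
derivative along the curve. -/
theorem norm_sub_le_integral_of_norm_fderiv_le {E : Type*} [NormedAddCommGroup E]
    [NormedSpace ℂ E] {f : E → ℂ} {Ω : Set E} {g : E → ℝ} {N : ℝ → E} {L : ℝ} (hL : 0 ≤ L)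
    (hΩo : IsOpen Ω) (hf : DifferentiableOn ℂ f Ω) (hg : ContinuousOn g Ω)
    (hfg : ∀ z ∈ Ω, ‖fderiv ℂ f z‖ ≤ g z) (hN : LipschitzOnWith 1 N (Icc 0 L))
    (hNΩ : MapsTo N (Icc 0 L) Ω) :
    ‖f (N L) - f (N 0)‖ ≤ ∫ s in 0..L, g (N s) := by
  have hgN : ContinuousOn (fun s => g (N s)) (Icc 0 L) := hg.comp hN.continuousOn hNΩ
  -- Extending the integrand by constants outside `[0, L]` makes its primitive differentiable at the
  -- endpoints too.
  set k : ℝ → ℝ := IccExtend hL ((Icc 0 L).domRestrict fun s => g (N s)) with hk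
  have hkc : Continuous k := (continuousOn_iff_continuous_domRestrict.1 hgN).Icc_extend'
  have hkN : ∀ s ∈ Icc 0 L, k s = g (N s) := fun s hs => by simp [hk, IccExtend_of_mem hL _ hs]
  have hder : ∀ s, HasDerivAt (fun t => ∫ x in 0..t, k x) (k s) s := fun s =>
    intervalIntegral.integral_hasDerivAt_right (hkc.intervalIntegrable _ _)
      hkc.stronglyMeasurable.stronglyMeasurableAtFilter hkc.continuousAt
  -- `N` is merely Lipschitz, so the chain rule is replaced by a comparison of right slopes with the
  -- primitive of `k`.
  have main := image_le_of_liminf_slope_right_le_deriv_boundary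
    (f := fun s => ‖f (N s) - f (N 0)‖) (a := 0) (b := L) (B := fun t => ∫ x in 0..t, k x) (B' := k)
    (((hf.continuousOn.comp hN.continuousOn hNΩ).sub continuousOn_const).norm) (by simp)
    (fun s _ => (hder s).continuousAt.continuousWithinAt)
    (fun s _ => (hder s).hasDerivWithinAt) ?_ (right_mem_Icc.2 hL)
  · refine main.trans_eq (intervalIntegral.integral_congr fun s hs => hkN s ?_)
    rwa [uIcc_of_le hL] at hs
  intro x hx r hr
  have hxI : x ∈ Icc 0 L := Ico_subset_Icc_self hx
  rw [hkN x hxI] at hr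
  -- The gap below `r'` absorbs the little-o error of the derivative; the gap above it gives the
  -- strict slope inequality.
  obtain ⟨r', hr', hr'r⟩ := exists_between hr
  have hd : HasFDerivAt f (fderiv ℂ f (N x)) (N x) :=
    (hf.differentiableAt (hΩo.mem_nhds (hNΩ hxI))).hasFDerivAt
  have hlip : ∀ᶠ y in 𝓝 (N x), ‖f y - f (N x)‖ ≤ r' * ‖y - N x‖ := by
    filter_upwards [hd.isLittleO.bound (sub_pos.2 ((hfg _ (hNΩ hxI)).trans_lt hr'))] with y hy
    calc ‖f y - f (N x)‖
        = ‖(f y - f (N x) - fderiv ℂ f (N x) (y - N x)) + fderiv ℂ f (N x) (y - N x)‖ := by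
          rw [sub_add_cancel]
      _ ≤ (r' - ‖fderiv ℂ f (N x)‖) * ‖y - N x‖ + ‖fderiv ℂ f (N x)‖ * ‖y - N x‖ :=
          norm_add_le_of_le hy (ContinuousLinearMap.le_opNorm _ _)
      _ = r' * ‖y - N x‖ := by ring
  have hmem : Icc 0 L ∈ 𝓝[>] x := Icc_mem_nhdsGT_of_mem hx
  have hNx : Tendsto N (𝓝[>] x) (𝓝 (N x)) :=
    (hN.continuousOn x hxI).tendsto.mono_left (nhdsWithin_le_of_mem hmem)
  refine Eventually.frequently ?_
  filter_upwards [hNx.eventually hlip, hmem, self_mem_nhdsWithin] with y hy hyI hxy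
  have hxy0 : 0 < y - x := sub_pos.2 hxy
  have hNxy : ‖N y - N x‖ ≤ y - x := by
    have := hN.dist_le_mul y hyI x hxI
    rwa [NNReal.coe_one, one_mul, dist_eq_norm, Real.dist_eq, abs_of_pos hxy0] at this
  have hr'0 : 0 ≤ r' := ((norm_nonneg _).trans (hfg _ (hNΩ hxI))).trans hr'.le
  rw [slope_def_field, div_lt_iff₀ hxy0]
  calc ‖f (N y) - f (N 0)‖ - ‖f (N x) - f (N 0)‖
      ≤ ‖(f (N y) - f (N 0)) - (f (N x) - f (N 0))‖ := norm_sub_norm_le _ _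
    _ = ‖f (N y) - f (N x)‖ := by rw [sub_sub_sub_cancel_right]
    _ ≤ r' * (y - x) := hy.trans (by gcongr)
    _ < r * (y - x) := by gcongr

section Internal

variable {n : ℕ} {ψ : ℝ → ℝ} {Ω : Set (EuclideanSpace ℂ (Fin n))}
  {f : EuclideanSpace ℂ (Fin n) → ℂ} {z w : EuclideanSpace ℂ (Fin n)} {C : ℝ}

theorem internalLipschitz_of_norm_fderiv_le (hψ : IsMajorant ψ) (hΩo : IsOpen Ω)
    (hfr : (frontier Ω).Nonempty) (hf : DifferentiableOn ℂ f Ω) (hC : 0 < C)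
    (hD : ∀ z ∈ Ω, ‖fderiv ℂ f z‖ ≤ C * (ψ (bdryDist Ω z) / bdryDist Ω z)) :
    InternalLipschitz ψ Ω f := by
  refine ⟨C, hC, fun z _ w _ => ?_⟩
  rw [internalDist, ENNReal.mul_iInf_of_ne (by simpa using hC) ENNReal.ofReal_ne_top]
  refine le_iInf fun γ => ?_
  rw [ENNReal.mul_iInf_of_ne (by simpa using hC) ENNReal.ofReal_ne_top]
  refine le_iInf fun hγ => ?_
  have hv : BoundedVariationOn γ (Icc 0 1) := hγ.rectifiable
  set L := (eVariationOn γ (Icc 0 1)).toReal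
  have hL : 0 ≤ L := ENNReal.toReal_nonneg
  set N := naturalParameterization γ (Icc 0 1) 0
  have hNL : LipschitzOnWith 1 N (Icc 0 L) :=
    lipschitzOnWith_naturalParameterization zero_le_one hγ.continuousOn hv
  have hNΩ : MapsTo N (Icc 0 L) Ω :=
    (mapsTo_naturalParameterization zero_le_one hγ.continuousOn hv).mono_right
      hγ.mapsTo.image_subset
  have hN0 : N 0 = z := (naturalParameterization_zero zero_le_one hv).trans hγ.source
  have hN1 : N L = w := (naturalParameterization_length zero_le_one hv).trans hγ.target
  have hgc := hψ.continuousOn_div_bdryDist hΩo hfr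
  have hbound := norm_sub_le_integral_of_norm_fderiv_le
    (g := fun ζ => C * (ψ (bdryDist Ω ζ) / bdryDist Ω ζ)) hL hΩo hf (continuousOn_const.mul hgc)
    hD hNL hNΩ
  have hgN : ContinuousOn (fun s => C * (ψ (bdryDist Ω (N s)) / bdryDist Ω (N s))) (Icc 0 L) :=
    continuousOn_const.mul (hgc.comp hNL.continuousOn hNΩ)
  rw [hN0, hN1, norm_sub_rev, intervalIntegral.integral_of_le hL,
    ← integral_Icc_eq_integral_Ioc] at hbound
  refine (ENNReal.ofReal_le_ofReal hbound).trans ?_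
  rw [ofReal_integral_eq_lintegral_ofReal (hgN.integrableOn_compact isCompact_Icc)]
  · simp_rw [ENNReal.ofReal_mul hC.le]
    rw [lintegral_const_mul' _ _ ENNReal.ofReal_ne_top]
    rfl
  · refine Eventually.of_forall fun s => ?_
    exact mul_nonneg hC.le (div_nonneg (hψ.nonneg Metric.infDist_nonneg) Metric.infDist_nonneg)

theorem InternalLipschitz.of_norm_sub_le {G H : Type*} [NormedAddCommGroup G]
    [NormedAddCommGroup H] {F : EuclideanSpace ℂ (Fin n) → G} {F' : EuclideanSpace ℂ (Fin n) → H}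
    (hF : InternalLipschitz ψ Ω F)
    (h : ∀ z ∈ Ω, ∀ w ∈ Ω, ‖F' z - F' w‖ ≤ ‖F z - F w‖) : InternalLipschitz ψ Ω F' := by
  obtain ⟨C, hC, hF⟩ := hF
  exact ⟨C, hC, fun z hz w hw => (ENNReal.ofReal_le_ofReal (h z hz w hw)).trans (hF z hz w hw)⟩

/-- The straight segment is an admissible curve: it stays in the half-radius ball, where the density
is at most twice its value at `z`. -/
theorem internalDist_le_of_mem_ball (hψ : IsMajorant ψ) (hΩo : IsOpen Ω)
    (hfr : (frontier Ω).Nonempty) (hz : z ∈ Ω) (hw : w ∈ Metric.ball z (bdryDist Ω z / 2)) :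
    internalDist ψ Ω w z ≤
      ENNReal.ofReal (2 * (ψ (bdryDist Ω z) / bdryDist Ω z) * ‖w - z‖) := by
  have hd := bdryDist_pos hΩo hfr hz
  set γ : ℝ → EuclideanSpace ℂ (Fin n) := ⇑(AffineMap.lineMap (k := ℝ) w z)
  have hγL : LipschitzWith (nndist w z) γ := lipschitzWith_lineMap w z
  have hlen : eVariationOn γ (Icc 0 1) ≤ ENNReal.ofReal ‖w - z‖ := by
    have h := hγL.lipschitzOnWith (s := univ) |>.comp_eVariationOn_le (g := id)
      (mapsTo_univ id (Icc (0 : ℝ) 1))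
    rw [eVariationOn_id_Icc] at h
    simpa [ENNReal.ofReal, ← nndist_eq_nnnorm] using h
  have hseg : MapsTo γ (Icc 0 1) (Metric.ball z (bdryDist Ω z / 2)) := fun t ht =>
    (convex_ball z (bdryDist Ω z / 2)).lineMap_mem hw (Metric.mem_ball_self (half_pos hd)) ht
  have hv : BoundedVariationOn γ (Icc 0 1) := ne_top_of_le_ne_top ENNReal.ofReal_ne_top hlen
  have hrect : IsRectifiableCurve Ω w z γ :=
    { continuousOn := hγL.continuous.continuousOn
      rectifiable := hv
      mapsTo := fun t ht => ball_bdryDist_subset hΩo hz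
        (Metric.ball_subset_ball (half_le_self hd.le) (hseg ht))
      source := AffineMap.lineMap_apply_zero _ _
      target := AffineMap.lineMap_apply_one _ _ }
  refine (iInf₂_le γ hrect).trans ?_
  have hK : 0 ≤ 2 * (ψ (bdryDist Ω z) / bdryDist Ω z) :=
    mul_nonneg zero_le_two (div_nonneg (hψ.nonneg hd.le) hd.le)
  calc arcLengthIntegral γ (fun ζ => ψ (bdryDist Ω ζ) / bdryDist Ω ζ)
      ≤ ∫⁻ _ in Icc 0 (eVariationOn γ (Icc 0 1)).toReal,
          ENNReal.ofReal (2 * (ψ (bdryDist Ω z) / bdryDist Ω z)) := by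
        refine setLIntegral_mono' measurableSet_Icc fun s hs => ENNReal.ofReal_le_ofReal ?_
        obtain ⟨t, ht, hts⟩ :=
          mapsTo_naturalParameterization zero_le_one hγL.continuous.continuousOn hv hs
        rw [← hts]
        exact hψ.div_le_two_mul hd (half_bdryDist_le (hseg ht))
    _ = ENNReal.ofReal (2 * (ψ (bdryDist Ω z) / bdryDist Ω z)) * eVariationOn γ (Icc 0 1) := by
        rw [setLIntegral_const, Real.volume_Icc, sub_zero, ENNReal.ofReal_toReal hv]
    _ ≤ _ := by
        rw [ENNReal.ofReal_mul hK]
        gcongr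

theorem InternalLipschitz.eventually_norm_sub_le {G : Type*} [NormedAddCommGroup G]
    {F : EuclideanSpace ℂ (Fin n) → G} (hψ : IsMajorant ψ) (hΩo : IsOpen Ω)
    (hfr : (frontier Ω).Nonempty) (hF : InternalLipschitz ψ Ω F) :
    ∃ C : ℝ, 0 < C ∧ ∀ z ∈ Ω, ∀ᶠ w in 𝓝 z,
      ‖F w - F z‖ ≤ C * (ψ (bdryDist Ω z) / bdryDist Ω z) * ‖w - z‖ := by
  obtain ⟨C, hC, hF⟩ := hF
  refine ⟨C * 2, by positivity, fun z hz => ?_⟩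
  have hd := bdryDist_pos hΩo hfr hz
  filter_upwards [Metric.ball_mem_nhds z (half_pos hd), hΩo.mem_nhds hz] with w hw hwΩ
  have h := (hF w hwΩ z hz).trans
    (mul_le_mul_right (internalDist_le_of_mem_ball hψ hΩo hfr hz hw) (ENNReal.ofReal C))
  rw [← ENNReal.ofReal_mul hC.le, ENNReal.ofReal_le_ofReal_iff] at h
  · exact h.trans_eq (by ring)
  · have := div_nonneg (hψ.nonneg hd.le) hd.le
    positivity

end Internal

/-- A one-sided bound on one real part suffices because `Df` is complex linear: for each `e` a
unimodular `c` makes `b * Df (c • e)` equal to `‖Df e‖`, and `z` is approached along `c • e / k`. -/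
theorem norm_fderiv_le_of_re_le {E : Type*} [NormedAddCommGroup E] [NormedSpace ℂ E] {f : E → ℂ}
    {z : E} {b : ℂ} {K : ℝ} (hd : DifferentiableAt ℂ f z) (hb : ‖b‖ = 1) (hK : 0 ≤ K)
    (h : ∀ᶠ w in 𝓝 z, (b * (f w - f z)).re ≤ K * ‖w - z‖) : ‖fderiv ℂ f z‖ ≤ K := by
  refine ContinuousLinearMap.opNorm_le_bound _ hK fun e => ?_
  obtain ⟨c, hc, hce⟩ := Complex.exists_norm_eq_mul_self (b * fderiv ℂ f z e)
  have hcn : Tendsto (fun k : ℕ => ‖(k : ℂ)‖) atTop atTop := by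
    simpa using tendsto_natCast_atTop_atTop (R := ℝ)
  have hlim := hd.hasFDerivAt.lim (c • e) hcn
  have hre : Tendsto (fun k : ℕ => (b * ((k : ℂ) • (f (z + (k : ℂ)⁻¹ • c • e) - f z))).re) atTop
      (𝓝 ‖fderiv ℂ f z e‖) := by
    have h1 := (Complex.continuous_re.tendsto _).comp (hlim.const_mul b)
    have h2 : (b * fderiv ℂ f z (c • e)).re = ‖fderiv ℂ f z e‖ := by
      rw [map_smul, smul_eq_mul, mul_left_comm, ← hce, Complex.ofReal_re, norm_mul, hb, one_mul]
    rwa [h2] at h1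
  have hto : Tendsto (fun k : ℕ => z + (k : ℂ)⁻¹ • c • e) atTop (𝓝 z) := by
    simpa using tendsto_const_nhds.add
      ((tendsto_inv_atTop_nhds_zero_nat (𝕜 := ℂ)).smul_const (c • e))
  refine le_of_tendsto hre ?_
  filter_upwards [hto.eventually h, eventually_gt_atTop 0] with k hk hk0
  have hk0' : (0 : ℝ) < k := Nat.cast_pos.2 hk0
  rw [add_sub_cancel_left, norm_smul, norm_smul, hc, one_mul, norm_inv, Complex.norm_natCast] at hk
  calc (b * ((k : ℂ) • (f (z + (k : ℂ)⁻¹ • c • e) - f z))).re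
      = k * (b * (f (z + (k : ℂ)⁻¹ • c • e) - f z)).re := by
        rw [smul_eq_mul, mul_left_comm, ← Complex.ofReal_natCast, Complex.re_ofReal_mul]
    _ ≤ k * (K * ((k : ℝ)⁻¹ * ‖e‖)) := by gcongr
    _ = K * ‖e‖ := by field_simp

section Internal

variable {n : ℕ} {ψ : ℝ → ℝ} {Ω : Set (EuclideanSpace ℂ (Fin n))}
  {f : EuclideanSpace ℂ (Fin n) → ℂ}

/-- If every real-linear increment of `f` at `z` in some direction of `ℂ` is controlled by the
increment of an internally Lipschitz function `F`, the derivative of `f` has the expected growth. -/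
theorem InternalLipschitz.norm_fderiv_le {G : Type*} [NormedAddCommGroup G]
    {F : EuclideanSpace ℂ (Fin n) → G} (hψ : IsMajorant ψ) (hΩo : IsOpen Ω)
    (hfr : (frontier Ω).Nonempty) (hf : DifferentiableOn ℂ f Ω) (hF : InternalLipschitz ψ Ω F)
    (h : ∀ z ∈ Ω, ∃ b : ℂ, ‖b‖ = 1 ∧ ∀ᶠ w in 𝓝 z, (b * (f w - f z)).re ≤ ‖F w - F z‖) :
    ∃ C : ℝ, 0 < C ∧ ∀ z ∈ Ω, ‖fderiv ℂ f z‖ ≤ C * (ψ (bdryDist Ω z) / bdryDist Ω z) := by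
  obtain ⟨C, hC, hF⟩ := hF.eventually_norm_sub_le hψ hΩo hfr
  refine ⟨C, hC, fun z hz => ?_⟩
  obtain ⟨b, hb, hbF⟩ := h z hz
  have hd := bdryDist_pos hΩo hfr hz
  refine norm_fderiv_le_of_re_le (hf.differentiableAt (hΩo.mem_nhds hz)) hb
    (mul_nonneg hC.le (div_nonneg (hψ.nonneg hd.le) hd.le)) ?_
  filter_upwards [hbF, hF z hz] with w h1 h2 using h1.trans h2

/-- Where `u z ≠ 0` the sign is locally constant; where `u z = 0` both sides are `|u w|`. -/
theorem eventually_abs_sub_le_abs_abs_sub {X : Type*} [TopologicalSpace X] {u : X → ℝ} {z : X}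
    (hu : ContinuousAt u z) : ∀ᶠ w in 𝓝 z, |u w - u z| ≤ |(|u w| - |u z|)| := by
  rcases lt_trichotomy (u z) 0 with h | h | h
  · filter_upwards [hu.eventually (gt_mem_nhds h)] with w hw
    rw [abs_of_neg hw, abs_of_neg h, neg_sub_neg, abs_sub_comm]
  · simp [h]
  · filter_upwards [hu.eventually (lt_mem_nhds h)] with w hw
    rw [abs_of_pos hw, abs_of_pos h]

/-- Choose `b` with `b * f z = ‖f z‖` and use `Re (b * f w) ≤ ‖f w‖`. -/
theorem exists_re_mul_sub_le_norm_norm_sub (f : EuclideanSpace ℂ (Fin n) → ℂ)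
    (z : EuclideanSpace ℂ (Fin n)) :
    ∃ b : ℂ, ‖b‖ = 1 ∧ ∀ w, (b * (f w - f z)).re ≤ ‖‖f w‖ - ‖f z‖‖ := by
  obtain ⟨b, hb, hbz⟩ := Complex.exists_norm_eq_mul_self (f z)
  refine ⟨b, hb, fun w => ?_⟩
  calc (b * (f w - f z)).re = (b * f w).re - ‖f z‖ := by
        rw [mul_sub, ← hbz, Complex.sub_re, Complex.ofReal_re]
    _ ≤ ‖f w‖ - ‖f z‖ := by
        have := Complex.re_le_norm (b * f w)
        rw [norm_mul, hb, one_mul] at this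
        linarith
    _ ≤ _ := Real.le_norm_self _

/-! ### The gradient of a pluriharmonic function -/

theorem EuclideanSpace.norm_dual_sq {n : ℕ} (D : EuclideanSpace ℂ (Fin n) →L[ℂ] ℂ) :
    ‖D‖ ^ 2 = ∑ j, ‖D (EuclideanSpace.single j 1)‖ ^ 2 := by
  have hD : ∀ x, D x = inner ℂ ((InnerProductSpace.toDual ℂ _).symm D) x := by simp
  rw [← (InnerProductSpace.toDual ℂ (EuclideanSpace ℂ (Fin n))).symm.norm_map D,
    EuclideanSpace.norm_sq_eq]
  refine Finset.sum_congr rfl fun j _ => ?_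
  rw [hD, EuclideanSpace.inner_single_right]
  simp

/-- By Cauchy–Riemann, the `x_j` and `y_j` derivatives of `u` are the real part and minus the
imaginary part of `a ∂_j f`; their squares add up to `|∂_j f|²`. -/
theorem gradNorm_eq_norm_fderiv {u : EuclideanSpace ℂ (Fin n) → ℝ} {z : EuclideanSpace ℂ (Fin n)}
    {a : ℂ} (ha : ‖a‖ = 1) (hd : DifferentiableAt ℂ f z)
    (hu : u =ᶠ[𝓝 z] fun w => (a * f w).re) : gradNorm u z = ‖fderiv ℂ f z‖ := by
  have hline : ∀ e, lineDeriv ℝ u z e = (a * fderiv ℂ f z e).re := by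
    intro e
    have h := (Complex.reCLM.hasFDerivAt.comp z
      ((hd.hasFDerivAt.const_mul a).restrictScalars ℝ)).congr_of_eventuallyEq hu
    simpa using (h.hasLineDerivAt e).lineDeriv
  rw [gradNorm, ← Real.sqrt_sq (norm_nonneg (fderiv ℂ f z)), EuclideanSpace.norm_dual_sq]
  congr 1
  refine Finset.sum_congr rfl fun j _ => ?_
  have hI : EuclideanSpace.single j Complex.I = Complex.I • EuclideanSpace.single j (1 : ℂ) := by
    ext i
    by_cases h : i = j <;> simp [h]
  set d := fderiv ℂ f z (EuclideanSpace.single j 1) with hddef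
  have hnorm : ‖d‖ ^ 2 = (a * d).re ^ 2 + (a * d).im ^ 2 := by
    rw [← one_mul ‖d‖, ← ha, ← norm_mul, Complex.sq_norm, Complex.normSq_apply]
    ring
  rw [hline, hline, hI, map_smul, smul_eq_mul, mul_left_comm, ← hddef, Complex.I_mul_re, hnorm]
  ring

end Internal

/-! ### Sub-mean value inequalities for powers of holomorphic functions -/

/-- In Jensen's formula the defect is a sum over zeros in the disc, with nonnegative multiplicities
and weights `log (1 / |x|) ≥ 0`. -/
theorem AnalyticOnNhd.log_norm_le_circleAverage {g : ℂ → ℂ}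
    (hg : AnalyticOnNhd ℂ g (Metric.closedBall 0 1)) (h0 : g 0 ≠ 0) :
    Real.log ‖g 0‖ ≤ Real.circleAverage (Real.log ‖g ·‖) 0 1 := by
  have hg' : AnalyticOnNhd ℂ g (Metric.closedBall 0 |(1 : ℝ)|) := by rwa [abs_one]
  rw [hg'.circleAverage_log_norm one_ne_zero h0, le_add_iff_nonneg_left]
  refine finsum_nonneg fun x => ?_
  by_cases hx : x ∈ Metric.closedBall (0 : ℂ) |(1 : ℝ)|
  · refine mul_nonneg (mod_cast MeromorphicOn.AnalyticOnNhd.divisor_nonneg hg' x) ?_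
    rcases eq_or_ne x 0 with rfl | hx0
    · simp
    · refine Real.log_nonneg ?_
      rw [one_mul, zero_sub, norm_neg]
      exact (one_le_inv₀ (norm_pos_iff.2 hx0)).2 (by simpa using hx)
  · simp [Function.locallyFinsuppWithin.apply_eq_zero_of_notMem _ hx]

/-- Jensen's inequality for `exp` applied to `p log |g|`. This works for all `p > 0`, with no
convexity of the power itself. -/
theorem AnalyticOnNhd.norm_rpow_mul_two_pi_le_lintegral {g : ℂ → ℂ} {p : ℝ} (hp : 0 < p)
    (hg : AnalyticOnNhd ℂ g (Metric.closedBall 0 1)) :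
    ENNReal.ofReal (‖g 0‖ ^ p) * ENNReal.ofReal (2 * Real.pi) ≤
      ∫⁻ θ in Ioc 0 (2 * Real.pi), ENNReal.ofReal (‖g (circleMap 0 1 θ)‖ ^ p) := by
  by_cases h0 : g 0 = 0
  · simp [h0, Real.zero_rpow hp.ne']
  have hπ : 0 < 2 * Real.pi := Real.two_pi_pos
  have hgc : Continuous fun θ => ‖g (circleMap 0 1 θ)‖ ^ p := by
    refine Continuous.rpow_const ?_ fun _ => Or.inr hp.le
    exact (hg.continuousOn.comp_continuous (continuous_circleMap 0 1)
      fun θ => circleMap_mem_closedBall 0 zero_le_one θ).norm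
  -- Since `g 0 ≠ 0`, `g` has finitely many zeros in the compact disc, and `circleMap` is injective
  -- on `(0, 2π]`.
  have hne : ∀ᵐ θ ∂volume.restrict (Ioc 0 (2 * Real.pi)), g (circleMap 0 1 θ) ≠ 0 := by
    rw [ae_restrict_iff' measurableSet_Ioc]
    refine Set.Finite.measure_zero ?_ _
    have hfin := (isCompact_closedBall (0 : ℂ) 1).finite_sdiff_of_mem_codiscreteWithin
      (hg.preimage_zero_mem_codiscreteWithin h0 (Metric.mem_closedBall_self zero_le_one)
        ((convex_closedBall (0 : ℂ) 1).isConnected (Metric.nonempty_closedBall.2 zero_le_one)))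
    refine Finite.of_finite_image (f := circleMap 0 1) (hfin.subset ?_) ?_
    · rintro _ ⟨θ, hθ, rfl⟩
      refine ⟨circleMap_mem_closedBall 0 zero_le_one θ, ?_⟩
      simpa using fun h => hθ fun _ => h
    · refine (injOn_circleMap_of_abs_sub_le (a := 0) (b := 2 * Real.pi) one_ne_zero
        (by simp [abs_of_pos Real.pi_pos])).mono ?_
      intro θ hθ
      rw [uIoc_of_le hπ.le]
      by_contra h
      exact hθ fun h' => absurd h' h
  have hexp : ∀ᵐ θ ∂volume.restrict (Ioc 0 (2 * Real.pi)),
      Real.exp (p * Real.log ‖g (circleMap 0 1 θ)‖) = ‖g (circleMap 0 1 θ)‖ ^ p := by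
    filter_upwards [hne] with θ hθ
    rw [Real.rpow_def_of_pos (norm_pos_iff.2 hθ), mul_comm]
  have hnz : NeZero (volume.restrict (Ioc 0 (2 * Real.pi))) :=
    ⟨by simp [Measure.restrict_eq_zero, Real.pi_pos]⟩
  have hint : IntegrableOn (fun θ => ‖g (circleMap 0 1 θ)‖ ^ p) (Ioc 0 (2 * Real.pi)) :=
    hgc.integrableOn_Icc.mono_set Ioc_subset_Icc_self
  have hlogint : IntegrableOn (fun θ => Real.log ‖g (circleMap 0 1 θ)‖) (Ioc 0 (2 * Real.pi)) :=
    (MeromorphicOn.circleIntegrable_log_norm (c := 0) (R := 1) (f := g) fun x hx =>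
      (hg x (by simpa using Metric.sphere_subset_closedBall hx)).meromorphicAt).1
  have hlog := hg.log_norm_le_circleAverage h0
  rw [Real.circleAverage_eq_intervalAverage, uIoc_of_le hπ.le] at hlog
  have hmain : ‖g 0‖ ^ p ≤ ⨍ θ in Ioc 0 (2 * Real.pi), ‖g (circleMap 0 1 θ)‖ ^ p :=
    calc ‖g 0‖ ^ p = Real.exp (p * Real.log ‖g 0‖) := by
          rw [Real.rpow_def_of_pos (norm_pos_iff.2 h0), mul_comm]
      _ ≤ Real.exp (⨍ θ in Ioc 0 (2 * Real.pi), p * Real.log ‖g (circleMap 0 1 θ)‖) := by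
          rw [average_eq, integral_const_mul, smul_eq_mul, mul_left_comm, ← smul_eq_mul (_⁻¹),
            ← average_eq]
          gcongr
      _ ≤ ⨍ θ in Ioc 0 (2 * Real.pi), Real.exp (p * Real.log ‖g (circleMap 0 1 θ)‖) := by
          refine convexOn_exp.map_average_le Real.continuousOn_exp isClosed_univ (by simp)
            (hlogint.const_mul p) ?_
          exact (integrable_congr hexp).mpr hint
      _ = _ := average_congr hexp
  rw [← ofReal_integral_eq_lintegral_ofReal hint
    (Eventually.of_forall fun θ => Real.rpow_nonneg (norm_nonneg _) p),
    ← ENNReal.ofReal_mul (Real.rpow_nonneg (norm_nonneg _) p)]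
  refine ENNReal.ofReal_le_ofReal ?_
  rw [setAverage_eq, smul_eq_mul, Measure.real, Real.volume_Ioc, sub_zero,
    ENNReal.toReal_ofReal hπ.le, inv_mul_eq_div, le_div_iff₀ hπ] at hmain
  exact hmain

/-- The sub-mean value inequality on circles for powers of a directional derivative of a
holomorphic function of several variables. -/
theorem norm_fderiv_apply_rpow_mul_two_pi_le_lintegral {E : Type*} [NormedAddCommGroup E]
    [NormedSpace ℂ E] [ProperSpace E] {f : E → ℂ} {Ω : Set E} {p : ℝ} (hp : 0 < p)
    (hΩo : IsOpen Ω) (hf : DifferentiableOn ℂ f Ω) (e : E) {z η : E}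
    (hzη : ∀ ζ ∈ Metric.closedBall (0 : ℂ) 1, z + ζ • η ∈ Ω) :
    ENNReal.ofReal (‖fderiv ℂ f z e‖ ^ p) * ENNReal.ofReal (2 * Real.pi) ≤
      ∫⁻ θ in Ioc 0 (2 * Real.pi), ENNReal.ofReal (‖fderiv ℂ f (z + circleMap 0 1 θ • η) e‖ ^ p) := by
  have hline : Continuous fun ζ : ℂ => z + ζ • η := by fun_prop
  set K := (fun ζ : ℂ => z + ζ • η) '' Metric.closedBall 0 1 with hKdef
  have hK : IsCompact K := (isCompact_closedBall 0 1).image hline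
  have hKΩ : K ⊆ Ω := image_subset_iff.2 hzη
  have hmemK : ∀ ζ ∈ Metric.closedBall (0 : ℂ) 1, z + ζ • η ∈ K := fun ζ hζ =>
    mem_image_of_mem _ hζ
  -- Compactness of the disc gives a margin `δ` and a bound `M` uniform over it, so that the
  -- difference quotients are defined and dominated.
  obtain ⟨δ, hδ, hδΩ⟩ := hK.exists_cthickening_subset_open hΩo hKΩ
  obtain ⟨M, hM⟩ := hK.cthickening.exists_bound_of_continuousOn (hf.continuousOn.mono hδΩ)
  have hball : ∀ x ∈ K, Metric.ball x δ ⊆ Metric.cthickening δ K := fun x hx =>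
    (Metric.ball_subset_closedBall).trans (Metric.closedBall_subset_cthickening hx δ)
  -- The inequality is proved for difference quotients, which are visibly holomorphic in `ζ`, and
  -- passed to the limit; analyticity of `Df` is never required.
  set q : ℕ → ℂ → ℂ := fun k ζ =>
    (k : ℂ) • (f (z + ζ • η + (k : ℂ)⁻¹ • e) - f (z + ζ • η)) with hq
  have hcn : Tendsto (fun k : ℕ => ‖(k : ℂ)‖) atTop atTop := by
    simpa using tendsto_natCast_atTop_atTop (R := ℝ)
  have hlim : ∀ ζ ∈ Metric.closedBall (0 : ℂ) 1,
      Tendsto (fun k => q k ζ) atTop (𝓝 (fderiv ℂ f (z + ζ • η) e)) := fun ζ hζ =>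
    (hf.differentiableAt (hΩo.mem_nhds (hzη ζ hζ))).hasFDerivAt.lim e hcn
  have hsmall : ∀ᶠ k : ℕ in atTop, 0 < k ∧ ‖(k : ℂ)⁻¹ • e‖ < δ := by
    refine (eventually_gt_atTop 0).and ?_
    have : Tendsto (fun k : ℕ => ‖(k : ℂ)⁻¹ • e‖) atTop (𝓝 0) := by
      simpa using ((tendsto_inv_atTop_nhds_zero_nat (𝕜 := ℂ)).smul_const e).norm
    exact this.eventually (gt_mem_nhds hδ)
  have hshift : ∀ k : ℕ, ‖(k : ℂ)⁻¹ • e‖ < δ → ∀ ζ ∈ Metric.closedBall (0 : ℂ) 1,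
      z + ζ • η + (k : ℂ)⁻¹ • e ∈ Metric.ball (z + ζ • η) δ := fun k hk ζ _ => by
    simpa [Metric.mem_ball, dist_eq_norm] using hk
  have han : ∀ᶠ k : ℕ in atTop, AnalyticOnNhd ℂ (q k) (Metric.closedBall 0 1) := by
    filter_upwards [hsmall] with k hk
    have hline' : Continuous fun ζ : ℂ => z + ζ • η + (k : ℂ)⁻¹ • e := by fun_prop
    have hU := (hΩo.preimage hline).inter (hΩo.preimage hline')
    have hdiff : DifferentiableOn ℂ (q k)
        ((fun ζ : ℂ => z + ζ • η) ⁻¹' Ω ∩ (fun ζ : ℂ => z + ζ • η + (k : ℂ)⁻¹ • e) ⁻¹' Ω) := by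
      refine DifferentiableOn.fun_const_smul (DifferentiableOn.fun_sub ?_ ?_) (k : ℂ)
      · exact hf.comp (g := f) (f := fun ζ : ℂ => z + ζ • η + (k : ℂ)⁻¹ • e)
          (by fun_prop) fun ζ hζ => hζ.2
      · exact hf.comp (g := f) (f := fun ζ : ℂ => z + ζ • η) (by fun_prop) fun ζ hζ => hζ.1
    refine (hdiff.analyticOnNhd hU).mono fun ζ hζ => ⟨hzη ζ hζ, ?_⟩
    exact hδΩ (hball _ (hmemK ζ hζ) (hshift k hk.2 ζ hζ))
  have hbound : ∀ᶠ k : ℕ in atTop, ∀ ζ ∈ Metric.closedBall (0 : ℂ) 1,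
      ‖q k ζ‖ ≤ 2 * M / δ * ‖e‖ := by
    filter_upwards [hsmall] with k hk ζ hζ
    have hk0 : (0 : ℝ) < k := Nat.cast_pos.2 hk.1
    have hx := hmemK ζ hζ
    have hmaps : MapsTo f (Metric.ball (z + ζ • η) δ) (Metric.closedBall (f (z + ζ • η)) (2 * M)) := by
      intro y hy
      rw [Metric.mem_closedBall, dist_eq_norm]
      have h1 := hM y (hball _ hx hy)
      have h2 := hM _ (hball _ hx (Metric.mem_ball_self hδ))
      exact (norm_sub_le _ _).trans (by linarith)
    -- The Schwarz lemma bounds the increment of `f` linearly in the shift, with a constant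
    -- independent of `k` and `ζ`.
    have h := Complex.dist_le_div_mul_dist_of_mapsTo_ball
      (hf.mono ((hball _ hx).trans hδΩ)) hmaps (hshift k hk.2 ζ hζ)
    rw [dist_eq_norm, dist_eq_norm, add_sub_cancel_left, norm_smul, norm_inv,
      Complex.norm_natCast] at h
    calc ‖q k ζ‖ = k * ‖f (z + ζ • η + (k : ℂ)⁻¹ • e) - f (z + ζ • η)‖ := by
          rw [hq, norm_smul, Complex.norm_natCast]
      _ ≤ k * (2 * M / δ * ((k : ℝ)⁻¹ * ‖e‖)) := by gcongr
      _ = 2 * M / δ * ‖e‖ := by field_simp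
  have hrpow : ∀ {c : ℕ → ℂ} {x : ℂ}, Tendsto c atTop (𝓝 x) →
      Tendsto (fun k => ENNReal.ofReal (‖c k‖ ^ p)) atTop (𝓝 (ENNReal.ofReal (‖x‖ ^ p))) :=
    fun h => ENNReal.tendsto_ofReal (h.norm.rpow_const (Or.inr hp.le))
  have hleft : Tendsto (fun k => ENNReal.ofReal (‖q k 0‖ ^ p) * ENNReal.ofReal (2 * Real.pi)) atTop
      (𝓝 (ENNReal.ofReal (‖fderiv ℂ f z e‖ ^ p) * ENNReal.ofReal (2 * Real.pi))) := by
    refine ENNReal.Tendsto.mul_const ?_ (Or.inr ENNReal.ofReal_ne_top)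
    simpa using hrpow (hlim 0 (Metric.mem_closedBall_self zero_le_one))
  have hcirc : ∀ θ, circleMap 0 1 θ ∈ Metric.closedBall (0 : ℂ) 1 := fun θ =>
    circleMap_mem_closedBall 0 zero_le_one θ
  have hright : Tendsto (fun k => ∫⁻ θ in Ioc 0 (2 * Real.pi),
      ENNReal.ofReal (‖q k (circleMap 0 1 θ)‖ ^ p)) atTop
      (𝓝 (∫⁻ θ in Ioc 0 (2 * Real.pi),
        ENNReal.ofReal (‖fderiv ℂ f (z + circleMap 0 1 θ • η) e‖ ^ p))) := by
    refine tendsto_lintegral_filter_of_dominated_convergence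
      (fun _ => ENNReal.ofReal ((2 * M / δ * ‖e‖) ^ p)) ?_ ?_ ?_ ?_
    · filter_upwards [han] with k hk
      have : Continuous fun θ => q k (circleMap 0 1 θ) :=
        hk.continuousOn.comp_continuous (continuous_circleMap 0 1) hcirc
      exact ENNReal.measurable_ofReal.comp
        (this.norm.rpow_const fun _ => Or.inr hp.le).measurable
    · filter_upwards [hbound] with k hk
      refine Eventually.of_forall fun θ => ENNReal.ofReal_le_ofReal ?_
      exact Real.rpow_le_rpow (norm_nonneg _) (hk _ (hcirc θ)) hp.le
    · rw [setLIntegral_const]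
      exact ENNReal.mul_ne_top ENNReal.ofReal_ne_top measure_Ioc_lt_top.ne
    · exact Eventually.of_forall fun θ => hrpow (hlim _ (hcirc θ))
  refine le_of_tendsto_of_tendsto hleft hright ?_
  filter_upwards [han] with k hk using hk.norm_rpow_mul_two_pi_le_lintegral hp

/-- Integrals over balls of `ℂⁿ` centred at `z` are averages over the rotations about `z`. -/
theorem two_pi_mul_setLIntegral_ball {n : ℕ} {h : EuclideanSpace ℂ (Fin n) → ℝ≥0∞}
    (hh : Measurable h) (z : EuclideanSpace ℂ (Fin n)) (r : ℝ) :
    ENNReal.ofReal (2 * Real.pi) * ∫⁻ w in Metric.ball z r, h w =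
      ∫⁻ η in Metric.ball 0 r, ∫⁻ θ in Ioc 0 (2 * Real.pi), h (z + circleMap 0 1 θ • η) := by
  set I := (Metric.ball z r).indicator h with hI
  have hIm : Measurable I := hh.indicator measurableSet_ball
  -- Multiplication by a unimodular scalar is a real-linear isometry, hence preserves volume.
  have hrot : ∀ θ : ℝ, ∫⁻ η, I (z + circleMap 0 1 θ • η) = ∫⁻ w, I w := by
    intro θ
    have hc : ‖circleMap 0 1 θ‖ = 1 := by simp
    have hc0 : circleMap 0 1 θ ≠ 0 := norm_pos_iff.1 (by rw [hc]; exact one_pos)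
    let R : EuclideanSpace ℂ (Fin n) ≃ₗᵢ[ℝ] EuclideanSpace ℂ (Fin n) :=
      { toLinearEquiv := (LinearEquiv.smulOfNeZero ℂ _ (circleMap 0 1 θ) hc0).restrictScalars ℝ
        norm_map' := fun η => by
          change ‖circleMap 0 1 θ • η‖ = ‖η‖
          rw [norm_smul, hc, one_mul] }
    rw [← lintegral_add_left_eq_self I z]
    exact R.measurePreserving.lintegral_comp (f := fun η => I (z + η))
      (hIm.comp (measurable_const_add z))
  have hmem : ∀ (θ : ℝ) (η : EuclideanSpace ℂ (Fin n)),
      z + circleMap 0 1 θ • η ∈ Metric.ball z r ↔ η ∈ Metric.ball 0 r := fun θ η => by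
    simp [Metric.mem_ball, dist_eq_norm, norm_smul]
  have hmeas : Measurable (Function.uncurry fun (θ : ℝ) (η : EuclideanSpace ℂ (Fin n)) =>
      I (z + circleMap 0 1 θ • η)) := by
    refine hIm.comp (Continuous.measurable ?_)
    exact continuous_const.add
      (((continuous_circleMap 0 1).comp continuous_fst).smul continuous_snd)
  calc ENNReal.ofReal (2 * Real.pi) * ∫⁻ w in Metric.ball z r, h w
      = ∫⁻ _ in Ioc 0 (2 * Real.pi), ∫⁻ w, I w := by
        rw [setLIntegral_const, Real.volume_Ioc, sub_zero, mul_comm, hI,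
          lintegral_indicator measurableSet_ball]
    _ = ∫⁻ θ in Ioc 0 (2 * Real.pi), ∫⁻ η, I (z + circleMap 0 1 θ • η) := by simp_rw [hrot]
    _ = ∫⁻ η, ∫⁻ θ in Ioc 0 (2 * Real.pi), I (z + circleMap 0 1 θ • η) :=
        lintegral_lintegral_swap hmeas.aemeasurable
    _ = _ := by
        rw [← lintegral_indicator measurableSet_ball]
        refine lintegral_congr fun η => ?_
        by_cases hη : η ∈ Metric.ball 0 r
        · rw [indicator_of_mem hη]
          exact lintegral_congr fun θ => indicator_of_mem ((hmem θ η).2 hη) h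
        · rw [indicator_of_notMem hη]
          simp_rw [hI, indicator_of_notMem (mt (hmem _ η).1 hη)]
          exact lintegral_zero

theorem norm_fderiv_apply_rpow_mul_volume_le_lintegral {n : ℕ} {f : EuclideanSpace ℂ (Fin n) → ℂ}
    {p r : ℝ} (hp : 0 < p) {z : EuclideanSpace ℂ (Fin n)}
    (hf : DifferentiableOn ℂ f (Metric.ball z r)) (e : EuclideanSpace ℂ (Fin n)) :
    ENNReal.ofReal (‖fderiv ℂ f z e‖ ^ p) * volume (Metric.ball z r) ≤
      ∫⁻ w in Metric.ball z r, ENNReal.ofReal (‖fderiv ℂ f w e‖ ^ p) := by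
  have hmeas : Measurable fun w => ENNReal.ofReal (‖fderiv ℂ f w e‖ ^ p) :=
    ENNReal.measurable_ofReal.comp ((measurable_fderiv_apply_const ℂ f e).norm.pow_const p)
  have hπ : ENNReal.ofReal (2 * Real.pi) ≠ 0 := by simp [Real.pi_pos]
  rw [← ENNReal.mul_le_mul_iff_right hπ ENNReal.ofReal_ne_top,
    two_pi_mul_setLIntegral_ball hmeas z r]
  calc ENNReal.ofReal (2 * Real.pi) *
        (ENNReal.ofReal (‖fderiv ℂ f z e‖ ^ p) * volume (Metric.ball z r))
      = ∫⁻ _ in Metric.ball (0 : EuclideanSpace ℂ (Fin n)) r,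
          ENNReal.ofReal (‖fderiv ℂ f z e‖ ^ p) * ENNReal.ofReal (2 * Real.pi) := by
        rw [setLIntegral_const, Measure.addHaar_ball_center volume z]
        ring
    _ ≤ _ := by
        refine setLIntegral_mono' measurableSet_ball fun η hη => ?_
        refine norm_fderiv_apply_rpow_mul_two_pi_le_lintegral hp Metric.isOpen_ball hf e
          fun ζ hζ => ?_
        rw [mem_ball_zero_iff] at hη
        rw [mem_closedBall_zero_iff] at hζ
        rw [Metric.mem_ball, dist_eq_norm, add_sub_cancel_left, norm_smul]
        exact (mul_le_of_le_one_left (norm_nonneg η) hζ).trans_lt hη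

/-! ### Averages of the gradient -/

/-- The normalized `p`-mean of a constant is that constant, so both average comparisons reduce to
comparing integrals. -/
theorem ENNReal.rpow_neg_mul_ofReal_rpow_mul_rpow {V : ℝ≥0∞} (hV : V ≠ 0) (hV' : V ≠ ∞) {p x : ℝ}
    (hp : 0 < p) (hx : 0 ≤ x) :
    V ^ (-1 / p) * (ENNReal.ofReal (x ^ p) * V) ^ (1 / p) = ENNReal.ofReal x := by
  rw [ENNReal.mul_rpow_of_nonneg _ _ (by positivity), ← ENNReal.ofReal_rpow_of_nonneg hx hp.le,
    ← ENNReal.rpow_mul, mul_one_div_cancel hp.ne', ENNReal.rpow_one, mul_left_comm,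
    ← ENNReal.rpow_add _ _ hV hV', ← add_div, neg_add_cancel, zero_div, ENNReal.rpow_zero, mul_one]

section Average

variable {n : ℕ} {ψ : ℝ → ℝ} {Ω : Set (EuclideanSpace ℂ (Fin n))}
  {f : EuclideanSpace ℂ (Fin n) → ℂ} {u : EuclideanSpace ℂ (Fin n) → ℝ} {p : ℝ}

theorem GradBound.gradAverageBound (hψ : IsMajorant ψ) (hΩo : IsOpen Ω)
    (hfr : (frontier Ω).Nonempty) (hp : 0 < p) (hu : GradBound ψ Ω u) :
    GradAverageBound ψ Ω u p := by
  obtain ⟨C, hC, hu⟩ := hu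
  refine ⟨C * 2, by positivity, fun z hz => ?_⟩
  have hd := bdryDist_pos hΩo hfr hz
  have hψd : 0 ≤ ψ (bdryDist Ω z) / bdryDist Ω z := div_nonneg (hψ.nonneg hd.le) hd.le
  have hV : volume (Metric.ball z (bdryDist Ω z / 2)) ≠ 0 :=
    (Metric.measure_ball_pos volume z (half_pos hd)).ne'
  rw [← ENNReal.rpow_neg_mul_ofReal_rpow_mul_rpow hV measure_ball_lt_top.ne hp
    (by positivity : 0 ≤ C * 2 * (ψ (bdryDist Ω z) / bdryDist Ω z)), gradAverage]
  gcongr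
  rw [← setLIntegral_const]
  refine setLIntegral_mono' measurableSet_ball fun w hw => ENNReal.ofReal_le_ofReal ?_
  refine Real.rpow_le_rpow (Real.sqrt_nonneg _) ?_ hp.le
  have hwΩ : w ∈ Ω :=
    ball_bdryDist_subset hΩo hz (Metric.ball_subset_ball (half_le_self hd.le) hw)
  rw [mul_assoc]
  exact (hu w hwΩ).trans
    (mul_le_mul_of_nonneg_left (hψ.div_le_two_mul hd (half_bdryDist_le hw)) hC.le)

theorem GradAverageBound.gradBound (hψ : IsMajorant ψ) (hΩo : IsOpen Ω)
    (hfr : (frontier Ω).Nonempty) (hf : DifferentiableOn ℂ f Ω) (hp : 0 < p)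
    (huf : ∀ z ∈ Ω, gradNorm u z = ‖fderiv ℂ f z‖) (hu : GradAverageBound ψ Ω u p) :
    GradBound ψ Ω u := by
  obtain ⟨C, hC, hu⟩ := hu
  refine ⟨C, hC, fun z hz => ?_⟩
  have hd := bdryDist_pos hΩo hfr hz
  have hK : 0 ≤ C * (ψ (bdryDist Ω z) / bdryDist Ω z) :=
    mul_nonneg hC.le (div_nonneg (hψ.nonneg hd.le) hd.le)
  have hV : volume (Metric.ball z (bdryDist Ω z / 2)) ≠ 0 :=
    (Metric.measure_ball_pos volume z (half_pos hd)).ne'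
  have hsub : Metric.ball z (bdryDist Ω z / 2) ⊆ Ω :=
    (Metric.ball_subset_ball (half_le_self hd.le)).trans (ball_bdryDist_subset hΩo hz)
  rw [huf z hz]
  -- The sub-mean value property is available for the scalar function `Df(·) e`, so the unit vector
  -- `e` is fixed before averaging.
  refine ContinuousLinearMap.opNorm_le_of_unit_norm hK fun e he => ?_
  rw [← ENNReal.ofReal_le_ofReal_iff hK, ← ENNReal.rpow_neg_mul_ofReal_rpow_mul_rpow hV
    measure_ball_lt_top.ne hp (norm_nonneg _)]
  refine le_trans ?_ (hu z hz)
  rw [gradAverage]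
  gcongr
  refine (norm_fderiv_apply_rpow_mul_volume_le_lintegral hp (hf.mono hsub) e).trans ?_
  refine setLIntegral_mono' measurableSet_ball fun w hw => ENNReal.ofReal_le_ofReal ?_
  rw [huf w (hsub hw)]
  refine Real.rpow_le_rpow (norm_nonneg _) ?_ hp.le
  simpa [he] using (fderiv ℂ f w).le_opNorm e

/-- The characterizations of the growth of the derivative of a holomorphic function `f` in terms of
the real part of a unimodular multiple of `f`. -/
theorem tfae_norm_fderiv_le_of_re (hψ : IsMajorant ψ) (hΩo : IsOpen Ω)
    (hfr : (frontier Ω).Nonempty) (hf : DifferentiableOn ℂ f Ω) (hp : 0 < p) {a : ℂ}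
    (ha : ‖a‖ = 1) (huf : ∀ z ∈ Ω, u z = (a * f z).re) :
    List.TFAE [
      ∃ C : ℝ, 0 < C ∧ ∀ z ∈ Ω, ‖fderiv ℂ f z‖ ≤ C * (ψ (bdryDist Ω z) / bdryDist Ω z),
      InternalLipschitz ψ Ω u,
      GradBound ψ Ω u,
      InternalLipschitz ψ Ω (fun z => |u z|),
      GradAverageBound ψ Ω u p] := by
  have hgrad : ∀ z ∈ Ω, gradNorm u z = ‖fderiv ℂ f z‖ := fun z hz =>
    gradNorm_eq_norm_fderiv ha (hf.differentiableAt (hΩo.mem_nhds hz))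
      (eventuallyEq_of_mem (hΩo.mem_nhds hz) huf)
  have hsub : ∀ z ∈ Ω, ∀ w ∈ Ω, (a * (f w - f z)).re = u w - u z := fun z hz w hw => by
    rw [huf z hz, huf w hw, mul_sub, Complex.sub_re]
  tfae_have 1 → 2 := fun ⟨C, hC, hD⟩ =>
    (internalLipschitz_of_norm_fderiv_le hψ hΩo hfr hf hC hD).of_norm_sub_le fun z hz w hw => by
      rw [← hsub w hw z hz]
      refine (Complex.abs_re_le_norm _).trans_eq ?_
      rw [norm_mul, ha, one_mul]
  tfae_have 2 → 4 := fun h => h.of_norm_sub_le fun z _ w _ => abs_abs_sub_abs_le_abs_sub _ _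
  tfae_have 4 → 1 := fun h => h.norm_fderiv_le hψ hΩo hfr hf fun z hz => by
    have huc : ContinuousAt u z := by
      refine ContinuousAt.congr ?_ (eventuallyEq_of_mem (hΩo.mem_nhds hz) huf).symm
      exact Complex.continuous_re.continuousAt.comp
        (continuousAt_const.mul (hf.continuousOn.continuousAt (hΩo.mem_nhds hz)))
    refine ⟨a, ha, ?_⟩
    filter_upwards [eventually_abs_sub_le_abs_abs_sub huc, hΩo.mem_nhds hz] with w hw hwΩ
    rw [hsub z hz w hwΩ]
    exact (le_abs_self _).trans hw
  tfae_have 1 ↔ 3 := by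
    unfold GradBound
    refine exists_congr fun C => and_congr_right fun _ => forall₂_congr fun z hz => ?_
    rw [hgrad z hz]
  tfae_have 3 → 5 := fun h => h.gradAverageBound hψ hΩo hfr hp
  tfae_have 5 → 3 := fun h => h.gradBound hψ hΩo hfr hf hp hgrad
  tfae_finish

end Average

end Auxiliary

theorem mainTheorem3 (n : ℕ) (hn : 1 ≤ n) (ψ : ℝ → ℝ) (hψ : IsFastMajorant ψ)
    (Ω : Set (EuclideanSpace ℂ (Fin n))) (hΩo : IsOpen Ω) (hΩc : IsConnected Ω)
    (hΩb : Bornology.IsBounded Ω)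
    (u v : EuclideanSpace ℂ (Fin n) → ℝ) (f : EuclideanSpace ℂ (Fin n) → ℂ)
    (hfuv : ∀ z ∈ Ω, f z = (u z : ℂ) + Complex.I * (v z : ℂ))
    (hf : DifferentiableOn ℂ f Ω)
    (p : ℝ) (hp : 0 < p) (hpn : 2 ≤ n → (2 * (n : ℝ) - 2) / (2 * (n : ℝ) - 1) ≤ p)
    (q : ℝ) (hq : 0 < q) (hqn : 2 ≤ n → (2 * (n : ℝ) - 2) / (2 * (n : ℝ) - 1) ≤ q) :
    List.TFAE [
      InternalLipschitz ψ Ω u,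
      GradBound ψ Ω u,
      InternalLipschitz ψ Ω (fun z => |u z|),
      GradAverageBound ψ Ω u p,
      InternalLipschitz ψ Ω v,
      GradBound ψ Ω v,
      InternalLipschitz ψ Ω (fun z => |v z|),
      GradAverageBound ψ Ω v q,
      InternalLipschitz ψ Ω f,
      InternalLipschitz ψ Ω (fun z => ‖f z‖)] := by
  have hψ' := hψ.toIsMajorant
  have hfr := frontier_nonempty_of_isBounded hn hΩb hΩc.nonempty
  -- The rotations `a = 1` and `a = -i` extract `u` and `v` from `f`. Entry 0 of both lists is the
  -- same bound on `Df`, which links the two families.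
  have hu := tfae_norm_fderiv_le_of_re hψ' hΩo hfr hf hp (u := u) (a := 1) norm_one
    fun z hz => by simp [hfuv z hz]
  have hv := tfae_norm_fderiv_le_of_re hψ' hΩo hfr hf hq (u := v) (a := -Complex.I) (by simp)
    fun z hz => by simp [hfuv z hz]
  have hlip : (∃ C : ℝ, 0 < C ∧
      ∀ z ∈ Ω, ‖fderiv ℂ f z‖ ≤ C * (ψ (bdryDist Ω z) / bdryDist Ω z)) →
      InternalLipschitz ψ Ω f := fun ⟨_, hC, hD⟩ =>
    internalLipschitz_of_norm_fderiv_le hψ' hΩo hfr hf hC hD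
  have hnorm (h : InternalLipschitz ψ Ω fun z => ‖f z‖) :=
    h.norm_fderiv_le hψ' hΩo hfr hf fun z _ =>
      (exists_re_mul_sub_le_norm_norm_sub f z).imp fun _ hb => ⟨hb.1, .of_forall hb.2⟩
  tfae_have 1 ↔ 2 := hu.out 1 2
  tfae_have 2 ↔ 3 := hu.out 2 3
  tfae_have 3 ↔ 4 := hu.out 3 4
  tfae_have 5 ↔ 6 := hv.out 1 2
  tfae_have 6 ↔ 7 := hv.out 2 3
  tfae_have 7 ↔ 8 := hv.out 3 4
  tfae_have 1 → 9 := fun h => hlip ((hu.out 1 0).1 h)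
  tfae_have 5 → 9 := fun h => hlip ((hv.out 1 0).1 h)
  tfae_have 9 → 10 := fun h => h.of_norm_sub_le fun z _ w _ => abs_norm_sub_norm_le _ _
  tfae_have 10 → 1 := fun h => (hu.out 0 1).1 (hnorm h)
  tfae_have 10 → 5 := fun h => (hv.out 0 1).1 (hnorm h)
  tfae_finish
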